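/- Let $h_1,\dots,h_M\in\mathbb{C}[x_0,\dots,x_n]$ be homogeneous polynomials and let $Y=\{y\in\mathbb{C}^n : h_1(1,y)=\cdots=h_M(1,y)=0\}$, with vanishing ideal $I(Y)=\langle g_1,\dots,g_N\rangle\subseteq\mathbb{C}[y]=\mathbb{C}[y_1,\dots,y_n]$ and coordinate ring $\mathbb{C}[Y]=\mathbb{C}[y]/I(Y)$. Order the monomials of $\mathbb{C}[y]$ by the graded lexicographic order with $1<y_1<\cdots<y_n<y_1^2<y_1y_2<\cdots$ (total degree first; in equal degree compare the exponents of $y_n$, then of $y_{n-1}$, and so on). Let $r\ge 1$, and let $B_0=\{y^{\beta_1},\dots,y^{\beta_r}\}$, listed increasingly, be the set of the first $r$ monomials whose images in $\mathbb{C}[Y]$ are linearly independent (chosen greedily: a monomial is skipped exactly when its image is linearly dependent on the images of those chosen before it; such $B_0$ is assumed to exist). Let $\partial B_1=(B_0\cup y_1B_0\cup\cdots\cup y_nB_0)\setminus B_0$. We identify monomials with their exponent vectors. For $G=(c_{i,\alpha})\in\mathbb{C}^{[r]\times\partial B_1}$ put $\varphi[G,\alpha]=\sum_{i=1}^r c_{i,\alpha}y^{\beta_i}-y^\alpha$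 for $\alpha\in\partial B_1$, $\varphi[G]=(\varphi[G,\alpha])_{\alpha\in\partial B_1}$, and let $J_G$ be the ideal generated by $\varphi[G]$. For $1\le i\le n$ let $M_i(G)\in\mathbb{C}^{r\times r}$ be the matrix whose $(s,t)$ entry is $c_{s,\beta_t+e_i}$ if $\beta_t+e_i\in\partial B_1$; if $\beta_t+e_i\in B_0$, it is $1$ when $\beta_s=\beta_t+e_i$ and $0$ otherwise. For $p\in\mathbb{C}[y]$ let $\mathrm{NF}(p;G)$ be the remainder of $p$ under the border division algorithm by $\varphi[G]$: the index of a monomial $m$ is the least degree of $m'$ over all factorizations $m=m'b_0$ with $b_0\in B_0$; as long as there are terms of positive index, a term $a\,m$ of maximal index $k$ is chosen, $b$ is the first monomial in $\partial B_1$ such that $m=m'b$ with $\deg m'=k-1$, and $a\,m'\varphi[G,b]$ is added. Then the following are equivalent. (a) The polynomial system $\varphi[G](y)=0$ has $r$ solutions counting multiplicities and they belong to $Y$. Precisely: the solution set $V\subset\mathbb{C}^n$ of the system is finite, $\sum_{v\in V}\dim_{\mathbb{C}}\mathcal{O}_v/J_G\mathcal{O}_v=r$, where $\mathcal{O}_v$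 is the local ring of $\mathbb{C}^n$ at $v$; and every $v\in V$ belongs to $Y$ with its multiplicity, that is, $v\in Y$ and $I(Y)\mathcal{O}_v\subseteq J_G\mathcal{O}_v$ (the latter is automatic at solutions $v\in Y$ of multiplicity one). (b) $M_i(G)M_j(G)=M_j(G)M_i(G)$ for all $1\le i<j\le n$, and $\mathrm{NF}(g_i;G)=0$ for all $i=1,\dots,N$. -/

import Mathlib

open MvPolynomial

noncomputable section

namespace STDX

/-- The graded lexicographic order on exponent vectors for which
`1 < y₁ < ⋯ < yₙ < y₁² < y₁y₂ < ⋯`: compare total degrees first, and in equal degree compare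
the exponents of the largest variable that occurs with different exponents. -/
def GrlexLT {n : ℕ} (a b : Fin n →₀ ℕ) : Prop :=
  a.degree < b.degree ∨
    (a.degree = b.degree ∧ ∃ i, a i < b i ∧ ∀ j, i < j → a j = b j)

/-- The dehomogenization `{y ∈ ℂⁿ : h₁(1, y) = ⋯ = h_M(1, y) = 0}`. -/
def dehomogenization {n M : ℕ} (h : Fin M → MvPolynomial (Fin (n + 1)) ℂ) :
    Set (Fin n → ℂ) :=
  {y | ∀ i, eval (Fin.cons 1 y : Fin (n + 1) → ℂ) (h i) = 0}

/-- The coordinate ring `ℂ[Y] = ℂ[y] / I(Y)`. -/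
abbrev CoordRing {n : ℕ} (Y : Set (Fin n → ℂ)) : Type :=
  MvPolynomial (Fin n) ℂ ⧸ (vanishingIdeal ℂ Y : Ideal (MvPolynomial (Fin n) ℂ))

/-- The image of the monomial `y ^ a` in `ℂ[Y]`. -/
def monomialClass {n : ℕ} (Y : Set (Fin n → ℂ)) (a : Fin n →₀ ℕ) : CoordRing Y :=
  Ideal.Quotient.mk _ (monomial a 1)

/-- `y ^ β₁, …, y ^ βᵣ` (listed increasingly) are the first `r` monomials whose images in
`ℂ[Y]` are linearly independent: the images are linearly independent, and every monomial that was
passed over is linearly dependent together with the monomials chosen before it. -/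
structure IsFirstIndependent {n r : ℕ} (Y : Set (Fin n → ℂ)) (β : Fin r → Fin n →₀ ℕ) :
    Prop where
  increasing : ∀ i j, i < j → GrlexLT (β i) (β j)
  independent : LinearIndependent ℂ fun i => monomialClass Y (β i)
  first : ∀ (i : Fin r) (γ : Fin n →₀ ℕ), GrlexLT γ (β i) → γ ∉ Set.range β →
    ¬ LinearIndepOn ℂ (monomialClass Y) (insert γ {δ | δ ∈ Set.range β ∧ GrlexLT δ γ})

/-- `B₀`, as a set of exponents. -/
def baseSet {n r : ℕ} (β : Fin r → Fin n →₀ ℕ) : Finset (Fin n →₀ ℕ) :=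
  Finset.univ.image β

/-- `B₁ = B₀ ∪ y₁ B₀ ∪ ⋯ ∪ yₙ B₀`. -/
def borderSet {n r : ℕ} (β : Fin r → Fin n →₀ ℕ) : Finset (Fin n →₀ ℕ) :=
  baseSet β ∪
    Finset.univ.biUnion fun i : Fin n => (baseSet β).image fun b => b + Finsupp.single i 1

/-- `∂B₁ = B₁ \ B₀`. -/
def boundary {n r : ℕ} (β : Fin r → Fin n →₀ ℕ) : Finset (Fin n →₀ ℕ) :=
  borderSet β \ baseSet β

/-- `φ[G, α] = ∑ᵢ c_{i,α} y ^ βᵢ - y ^ α`. -/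
def phi {n r : ℕ} {β : Fin r → Fin n →₀ ℕ} (G : Matrix (Fin r) (boundary β) ℂ)
    (α : boundary β) : MvPolynomial (Fin n) ℂ :=
  ∑ i, C (G i α) * monomial (β i) 1 - monomial (α : Fin n →₀ ℕ) 1

/-- The matrix `Mᵢ(G)`. -/
def multMatrix {n r : ℕ} {β : Fin r → Fin n →₀ ℕ} (G : Matrix (Fin r) (boundary β) ℂ)
    (i : Fin n) : Matrix (Fin r) (Fin r) ℂ :=
  Matrix.of fun s t =>
    if h : β t + Finsupp.single i 1 ∈ boundary β then G s ⟨_, h⟩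
    else if β s = β t + Finsupp.single i 1 then 1 else 0

/-! ### Border division -/

/-- The index of a monomial `y ^ t` with respect to `B₀`: the least `k` such that `y ^ t` is
the product of a monomial of degree `k` and an element of `B₀`. -/
def borderIndex {n r : ℕ} (β : Fin r → Fin n →₀ ℕ) (t : Fin n →₀ ℕ) : ℕ :=
  sInf {k | ∃ (s : Fin n →₀ ℕ) (j : Fin r), t = s + β j ∧ s.degree = k}

/-- `y ^ t = y ^ s · y ^ b` where `b ∈ ∂B₁` and `|s|` is the index of `t` minus one. -/
def IsReducer {n r : ℕ} (β : Fin r → Fin n →₀ ℕ) (t : Fin n →₀ ℕ) (b : boundary β) : Prop :=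
  ∃ s : Fin n →₀ ℕ, t = s + b ∧ s.degree + 1 = borderIndex β t

/-- The boundary monomial that the border division algorithm uses to reduce `y ^ t`:
the first one, in the graded lexicographic order, among those that are possible. -/
def IsFirstReducer {n r : ℕ} (β : Fin r → Fin n →₀ ℕ) (t : Fin n →₀ ℕ) (b : boundary β) :
    Prop :=
  IsReducer β t b ∧ ∀ b' : boundary β, IsReducer β t b' → ¬ GrlexLT (b' : Fin n →₀ ℕ) b

open Classical in
/-- One division step on a monomial: a monomial `y ^ t` outside `B₀` is replaced by
`y ^ t + y ^ (t - b) φ[G, b]`, with `b` as above, and a monomial in `B₀` (which has index `0`)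
is left alone. -/
def reduceMonomial {n r : ℕ} {β : Fin r → Fin n →₀ ℕ} (G : Matrix (Fin r) (boundary β) ℂ)
    (t : Fin n →₀ ℕ) : MvPolynomial (Fin n) ℂ :=
  if h : ∃ b : boundary β, IsFirstReducer β t b then
    monomial t 1 + monomial (t - (h.choose : Fin n →₀ ℕ)) 1 * phi G h.choose
  else monomial t 1

/-- One division step on each term of a polynomial. -/
def reduceOnce {n r : ℕ} {β : Fin r → Fin n →₀ ℕ} (G : Matrix (Fin r) (boundary β) ℂ)
    (p : MvPolynomial (Fin n) ℂ) : MvPolynomial (Fin n) ℂ :=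
  ∑ t ∈ p.support, C (coeff t p) * reduceMonomial G t

/-- `NF(p; G)`, the remainder of `p` in the border division algorithm by `φ[G]`. Each step lowers
the positive indices of the terms, so the number of steps below leaves terms in `B₀` only. The
step for a term depends on that term alone, so terms may be reduced simultaneously. -/
def NF {n r : ℕ} {β : Fin r → Fin n →₀ ℕ} (G : Matrix (Fin r) (boundary β) ℂ)
    (p : MvPolynomial (Fin n) ℂ) : MvPolynomial (Fin n) ℂ :=
  (reduceOnce G)^[p.support.sup (borderIndex β)] p

/-! ### Solutions of a polynomial system with multiplicities -/

/-- The solutions in `ℂⁿ` of the system `F = 0`. -/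
def solutions {n : ℕ} {ι : Type*} (F : ι → MvPolynomial (Fin n) ℂ) : Set (Fin n → ℂ) :=
  {v | ∀ i, eval v (F i) = 0}

/-- The local ring of `ℂⁿ` at the point `v`. -/
abbrev LocalRingAt {n : ℕ} (v : Fin n → ℂ) : Type :=
  Localization.AtPrime (vanishingIdeal ℂ {v} : Ideal (MvPolynomial (Fin n) ℂ))

/-- The extension of an ideal of `ℂ[y]` to the local ring at `v`. -/
def localIdeal {n : ℕ} (I : Ideal (MvPolynomial (Fin n) ℂ)) (v : Fin n → ℂ) :
    Ideal (LocalRingAt v) :=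
  I.map (algebraMap (MvPolynomial (Fin n) ℂ) (LocalRingAt v))

/-- The multiplicity of `v` as a solution of `F = 0`: the complex dimension of the local ring
at `v` modulo the equations. -/
def solutionMultiplicity {n : ℕ} {ι : Type*} (F : ι → MvPolynomial (Fin n) ℂ)
    (v : Fin n → ℂ) : ℕ :=
  Module.finrank ℂ (LocalRingAt v ⧸ localIdeal (Ideal.span (Set.range F)) v)

/-- `F = 0` has (finitely many solutions and) exactly `r` solutions counting multiplicities. -/
def HasSolutionsCounted {n : ℕ} {ι : Type*} (F : ι → MvPolynomial (Fin n) ℂ) (r : ℕ) : Prop :=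
  (solutions F).Finite ∧ ∑ᶠ v ∈ solutions F, solutionMultiplicity F v = r

/-- The solutions of `F = 0`, as points with multiplicities, belong to `Y`: every solution `v`
is a point of `Y`, and the multiple point that `F = 0` cuts out at `v` is contained in `Y`,
that is, the functions vanishing on `Y` vanish in its local ring `𝒪_v / (F)`.
At a solution of multiplicity one the second condition follows from `v ∈ Y`. -/
def SolutionsBelongTo {n : ℕ} {ι : Type*} (F : ι → MvPolynomial (Fin n) ℂ)
    (Y : Set (Fin n → ℂ)) : Prop :=
  ∀ v ∈ solutions F, v ∈ Y ∧
    localIdeal (vanishingIdeal ℂ Y) v ≤ localIdeal (Ideal.span (Set.range F)) v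

end STDX

end

/-! Let J be the ideal generated by φ[G] and A = ℂ[y]/J. Border division shows that the classes of
B₀ span A for every G (`span_baseClass`), so A is Artinian. It is the product of its local rings at
the solutions, whence dim A is the number of solutions with multiplicity
(`hasSolutionsCounted_finrank`). Having r solutions therefore means that B₀ is a basis of A.

This is equivalent to commutation. If B₀ is a basis, the Mᵢ(G) represent multiplication by yᵢ
(`multMatrix_mul_comm`). If they commute, they make ℂ^r a ℂ[y]-module on which a relation among the
classes of B₀ can be tested (`linearIndependent_baseClass`). That argument builds each monomial of
B₀ from 1 inside B₀, which the greedy choice permits (`mem_range_of_add_single`).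

The solutions belong to Y exactly when I(Y) ⊆ J, because inclusion of ideals is local and Y is
Zariski closed. Once B₀ is a basis of A, g lies in J if and only if its normal form is 0. -/

noncomputable section

namespace STDX

/-! ### The graded lexicographic order -/

section Order

variable {n : ℕ}

theorem GrlexLT.irrefl (a : Fin n →₀ ℕ) : ¬ GrlexLT a a := by
  rintro (h | ⟨-, i, h, -⟩) <;> exact lt_irrefl _ h

theorem GrlexLT.trans {a b c : Fin n →₀ ℕ} (hab : GrlexLT a b) (hbc : GrlexLT b c) :
    GrlexLT a c := by
  rcases hab with hab | ⟨hab, i, hi, hi'⟩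
  · rcases hbc with hbc | ⟨hbc, -⟩
    · exact Or.inl (hab.trans hbc)
    · exact Or.inl (hbc ▸ hab)
  · rcases hbc with hbc | ⟨hbc, j, hj, hj'⟩
    · exact Or.inl (hab ▸ hbc)
    · refine Or.inr ⟨hab.trans hbc, ?_⟩
      rcases lt_trichotomy i j with hij | rfl | hij
      · exact ⟨j, hi' j hij ▸ hj, fun k hk => (hi' k (hij.trans hk)).trans (hj' k hk)⟩
      · exact ⟨i, hi.trans hj, fun k hk => (hi' k hk).trans (hj' k hk)⟩
      · exact ⟨i, hj' i hij ▸ hi, fun k hk => (hi' k hk).trans (hj' k (hij.trans hk))⟩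

theorem GrlexLT.add_right {a b : Fin n →₀ ℕ} (h : GrlexLT a b) (c : Fin n →₀ ℕ) :
    GrlexLT (a + c) (b + c) := by
  rcases h with h | ⟨h, i, hi, hi'⟩
  · exact Or.inl (by simpa using h)
  · exact Or.inr ⟨by simpa using h, i, by simpa using hi, fun j hj => by simp [hi' j hj]⟩

theorem grlexLT_add_single (a : Fin n →₀ ℕ) (i : Fin n) :
    GrlexLT a (a + Finsupp.single i 1) :=
  Or.inl (by simp)

end Order

/-! ### Greedy choice: B₀ is closed under divisors -/

namespace IsFirstIndependent

variable {n r : ℕ} {Y : Set (Fin n → ℂ)} {β : Fin r → Fin n →₀ ℕ}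

theorem injective (hβ : IsFirstIndependent Y β) : Function.Injective β := by
  intro i j hij
  by_contra hne
  rcases lt_or_gt_of_ne hne with h | h
  · exact GrlexLT.irrefl _ (hij ▸ hβ.increasing i j h)
  · exact GrlexLT.irrefl _ (hij ▸ hβ.increasing j i h)

theorem linearIndepOn_range (hβ : IsFirstIndependent Y β) :
    LinearIndepOn ℂ (monomialClass Y) (Set.range β) :=
  (linearIndepOn_range_iff hβ.injective (monomialClass Y)).2 hβ.independent

/-- A monomial below a chosen one lies in the span of the chosen monomials up to it. -/
theorem mem_span_of_grlexLT (hβ : IsFirstIndependent Y β) {i : Fin r} {γ : Fin n →₀ ℕ}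
    (h : GrlexLT γ (β i)) :
    monomialClass Y γ ∈
      Submodule.span ℂ (monomialClass Y '' {δ | δ ∈ Set.range β ∧ GrlexLT δ (β i)}) := by
  by_cases hγ : γ ∈ Set.range β
  · exact Submodule.subset_span ⟨γ, ⟨hγ, h⟩, rfl⟩
  · have hind : LinearIndepOn ℂ (monomialClass Y) {δ | δ ∈ Set.range β ∧ GrlexLT δ γ} :=
      hβ.linearIndepOn_range.mono fun δ hδ => hδ.1
    have := mt hind.insert (hβ.first i γ h hγ)
    rw [not_not] at this
    have hsub : {δ | δ ∈ Set.range β ∧ GrlexLT δ γ} ⊆ {δ | δ ∈ Set.range β ∧ GrlexLT δ (β i)} :=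
      fun δ hδ => ⟨hδ.1, hδ.2.trans h⟩
    exact Submodule.span_mono (Set.image_mono hsub) this

/-- A skipped γ is a combination of smaller chosen monomials. Multiplying by yᵢ would make `β t`
dependent on chosen monomials below it. -/
theorem mem_range_of_add_single (hβ : IsFirstIndependent Y β) {t : Fin r} {γ : Fin n →₀ ℕ}
    {i : Fin n} (h : γ + Finsupp.single i 1 = β t) : γ ∈ Set.range β := by
  by_contra hγ
  have hlt : GrlexLT γ (β t) := h ▸ grlexLT_add_single γ i
  have hind : LinearIndepOn ℂ (monomialClass Y) {δ | δ ∈ Set.range β ∧ GrlexLT δ γ} :=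
    hβ.linearIndepOn_range.mono fun δ hδ => hδ.1
  have hspan := mt hind.insert (hβ.first t γ hlt hγ)
  rw [not_not] at hspan
  have hmul : ∀ δ : Fin n →₀ ℕ, LinearMap.mulLeft ℂ (Ideal.Quotient.mk _ (X i) : CoordRing Y)
      (monomialClass Y δ) = monomialClass Y (δ + Finsupp.single i 1) := by
    intro δ
    rw [LinearMap.mulLeft_apply, monomialClass, monomialClass, ← map_mul, X, monomial_mul,
      add_comm, one_mul]
  have himg := Submodule.mem_map_of_mem
    (f := LinearMap.mulLeft ℂ (Ideal.Quotient.mk _ (X i) : CoordRing Y)) hspan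
  rw [Submodule.map_span, hmul, h] at himg
  -- The products lie below `β t` but need not be chosen, so they are expanded again in chosen
  -- monomials.
  have hle : Submodule.span ℂ (LinearMap.mulLeft ℂ (Ideal.Quotient.mk _ (X i) : CoordRing Y) ''
      (monomialClass Y '' {δ | δ ∈ Set.range β ∧ GrlexLT δ γ})) ≤
      Submodule.span ℂ (monomialClass Y '' {δ | δ ∈ Set.range β ∧ GrlexLT δ (β t)}) := by
    rw [Submodule.span_le]
    rintro _ ⟨_, ⟨δ, hδ, rfl⟩, rfl⟩
    rw [hmul]
    exact hβ.mem_span_of_grlexLT (h ▸ hδ.2.add_right _)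
  have hmem := hle himg
  have hset : {δ | δ ∈ Set.range β ∧ GrlexLT δ (β t)} ⊆ β '' {s | s ≠ t} := by
    rintro _ ⟨⟨s, rfl⟩, hs⟩
    exact ⟨s, fun hst => GrlexLT.irrefl _ (hst ▸ hs), rfl⟩
  have hmem' := Submodule.span_mono (Set.image_mono hset) hmem
  rw [← Set.image_comp] at hmem'
  exact hβ.independent.notMem_span_image (s := {s | s ≠ t}) (x := t) (by simp) hmem'

theorem zero_mem_range (hβ : IsFirstIndependent Y β) (hr : 0 < r) : 0 ∈ Set.range β := by
  have key : ∀ (d : ℕ) (γ : Fin n →₀ ℕ), γ.degree = d → γ ∈ Set.range β →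
      0 ∈ Set.range β := by
    intro d
    induction d with
    | zero =>
      intro γ hd hγ
      rwa [(Finsupp.degree_eq_zero_iff γ).1 hd] at hγ
    | succ d ih =>
      rintro γ hd ⟨t, rfl⟩
      have hne : β t ≠ 0 := fun h0 => by simp [h0] at hd
      obtain ⟨i, hi⟩ := Finsupp.ne_iff.1 hne
      have hle : Finsupp.single i 1 ≤ β t := by
        rw [Finsupp.single_le_iff]
        exact Nat.one_le_iff_ne_zero.2 hi
      have hsub := tsub_add_cancel_of_le hle
      refine ih (β t - Finsupp.single i 1) ?_ (hβ.mem_range_of_add_single hsub)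
      have := congrArg Finsupp.degree hsub
      simp only [map_add, Finsupp.degree_single] at this
      omega
  exact key _ (β ⟨0, hr⟩) rfl ⟨_, rfl⟩

end IsFirstIndependent

/-! ### Border division: termination and remainders -/

section BorderDivision

variable {n r : ℕ} {β : Fin r → Fin n →₀ ℕ}

theorem mem_borderSet_add_single (j : Fin r) (i : Fin n) :
    β j + Finsupp.single i 1 ∈ borderSet β := by
  simp only [borderSet, baseSet, Finset.mem_union, Finset.mem_biUnion, Finset.mem_image,
    Finset.mem_univ, true_and]
  exact Or.inr ⟨i, β j, ⟨j, rfl⟩, rfl⟩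

theorem mem_baseSet {t : Fin n →₀ ℕ} : t ∈ baseSet β ↔ t ∈ Set.range β := by
  simp [baseSet]

theorem exists_add_single_of_mem_boundary {b : Fin n →₀ ℕ} (hb : b ∈ boundary β) :
    ∃ (i : Fin n) (t : Fin r), β t + Finsupp.single i 1 = b := by
  simp only [boundary, borderSet, baseSet, Finset.mem_sdiff, Finset.mem_union,
    Finset.mem_biUnion, Finset.mem_image, Finset.mem_univ, true_and] at hb
  obtain ⟨h | ⟨i, _, ⟨t, rfl⟩, h⟩, hn⟩ := hb
  · exact (hn h).elim
  · exact ⟨i, t, h⟩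

theorem borderIndex_add_le (s : Fin n →₀ ℕ) (j : Fin r) : borderIndex β (s + β j) ≤ s.degree :=
  Nat.sInf_le ⟨s, j, rfl, rfl⟩

/-- 1 ∈ B₀ keeps the set of degrees nonempty, so the infimum is attained and is not the default
value 0 of `sInf ∅`. -/
theorem exists_degree_eq_borderIndex (h0 : 0 ∈ Set.range β) (t : Fin n →₀ ℕ) :
    ∃ (s : Fin n →₀ ℕ) (j : Fin r), t = s + β j ∧ s.degree = borderIndex β t := by
  obtain ⟨j, hj⟩ := h0
  exact Nat.sInf_mem (s := {k | ∃ (s : Fin n →₀ ℕ) (j : Fin r), t = s + β j ∧ s.degree = k})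
    ⟨_, t, j, by simp [hj], rfl⟩

theorem borderIndex_le_zero_iff (h0 : 0 ∈ Set.range β) {t : Fin n →₀ ℕ} :
    borderIndex β t ≤ 0 ↔ t ∈ Set.range β := by
  constructor
  · intro h
    obtain ⟨s, j, hs, hd⟩ := exists_degree_eq_borderIndex h0 t
    have hs0 : s = 0 := (Finsupp.degree_eq_zero_iff s).1 (by omega)
    exact ⟨j, by simp [hs, hs0]⟩
  · rintro ⟨j, rfl⟩
    simpa using borderIndex_add_le (β := β) 0 j

/-- One variable of a cofactor of least degree is moved onto the factor in B₀. The result cannot be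
in B₀, since the index would then drop. -/
theorem exists_isReducer (h0 : 0 ∈ Set.range β) {t : Fin n →₀ ℕ} (ht : 0 < borderIndex β t) :
    ∃ b : boundary β, IsReducer β t b := by
  obtain ⟨s, j, hs, hd⟩ := exists_degree_eq_borderIndex h0 t
  have hne : s ≠ 0 := by
    rintro rfl
    simp at hd
    omega
  obtain ⟨i, hi⟩ := Finsupp.ne_iff.1 hne
  have hle : Finsupp.single i 1 ≤ s := by
    rw [Finsupp.single_le_iff]
    exact Nat.one_le_iff_ne_zero.2 hi
  obtain ⟨u, rfl⟩ := exists_add_of_le hle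
  have hu : u.degree + 1 = borderIndex β t := by
    rw [← hd, map_add, Finsupp.degree_single, add_comm]
  have heq : t = u + (β j + Finsupp.single i 1) := by rw [hs]; abel
  refine ⟨⟨β j + Finsupp.single i 1, ?_⟩, u, heq, hu⟩
  refine Finset.mem_sdiff.2 ⟨mem_borderSet_add_single j i, fun hmem => ?_⟩
  obtain ⟨k, hk⟩ := mem_baseSet.1 hmem
  have := borderIndex_add_le (β := β) u k
  rw [hk, ← heq] at this
  omega

theorem exists_isFirstReducer (h0 : 0 ∈ Set.range β) {t : Fin n →₀ ℕ}
    (ht : 0 < borderIndex β t) : ∃ b : boundary β, IsFirstReducer β t b := by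
  let R : boundary β → boundary β → Prop := fun b b' => GrlexLT (b : Fin n →₀ ℕ) b'
  have : IsTrans (boundary β) R := ⟨fun _ _ _ => GrlexLT.trans⟩
  have : Std.Irrefl R := ⟨fun _ => GrlexLT.irrefl _⟩
  obtain ⟨b, hb, hmin⟩ := (Finite.wellFounded_of_trans_of_irrefl R).has_min
    {b | IsReducer β t b} (exists_isReducer h0 ht)
  exact ⟨b, hb, fun b' hb' => hmin b' hb'⟩

variable (G : Matrix (Fin r) (boundary β) ℂ)

theorem reduceMonomial_sub_mem (t : Fin n →₀ ℕ) :
    reduceMonomial G t - monomial t 1 ∈ Ideal.span (Set.range (phi G)) := by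
  unfold reduceMonomial
  split_ifs with h
  · rw [add_sub_cancel_left]
    exact Ideal.mul_mem_left _ _ (Ideal.subset_span ⟨_, rfl⟩)
  · simp

/-- The term `y ^ t` cancels, and what remains is the cofactor, of degree one less than the index,
times elements of B₀. -/
theorem reduceMonomial_mem_of_pos (h0 : 0 ∈ Set.range β) {t : Fin n →₀ ℕ}
    (ht : 0 < borderIndex β t) :
    reduceMonomial G t ∈ restrictSupport ℂ {u | borderIndex β u + 1 ≤ borderIndex β t} := by
  have h := exists_isFirstReducer h0 ht
  rw [reduceMonomial, dif_pos h]
  obtain ⟨s, hs, hd⟩ := h.choose_spec.1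
  generalize h.choose = b at hs hd
  have hsub : t - (b : Fin n →₀ ℕ) = s := by rw [hs, add_tsub_cancel_right]
  have heq : monomial t 1 + monomial (t - (b : Fin n →₀ ℕ)) 1 * phi G b =
      ∑ i, monomial (s + β i) (G i b) := by
    simp only [hsub, phi, mul_sub, Finset.mul_sum, C_mul_monomial, monomial_mul, one_mul, mul_one,
      ← hs, add_sub_cancel]
  rw [heq]
  refine Submodule.sum_mem _ fun i _ => ?_
  refine (monomial_mem_restrictSupport ℂ).2 (Or.inl ?_)
  have := borderIndex_add_le (β := β) s i
  simp only [Set.mem_ofPred_eq]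
  omega

theorem reduceMonomial_of_borderIndex_eq_zero {t : Fin n →₀ ℕ} (ht : borderIndex β t = 0) :
    reduceMonomial G t = monomial t 1 := by
  refine dif_neg ?_
  rintro ⟨b, ⟨s, -, hd⟩, -⟩
  omega

theorem reduceOnce_sub_mem (p : MvPolynomial (Fin n) ℂ) :
    reduceOnce G p - p ∈ Ideal.span (Set.range (phi G)) := by
  nth_rewrite 2 [p.as_sum]
  rw [reduceOnce, ← Finset.sum_sub_distrib]
  refine Ideal.sum_mem _ fun t _ => ?_
  rw [← mul_one (coeff t p), ← C_mul_monomial, mul_one, ← mul_sub]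
  exact Ideal.mul_mem_left _ _ (reduceMonomial_sub_mem G t)

theorem reduceOnce_mem (h0 : 0 ∈ Set.range β) {k : ℕ} {p : MvPolynomial (Fin n) ℂ}
    (hp : p ∈ restrictSupport ℂ {u | borderIndex β u ≤ k + 1}) :
    reduceOnce G p ∈ restrictSupport ℂ {u | borderIndex β u ≤ k} := by
  rw [mem_restrictSupport_iff] at hp
  refine Submodule.sum_mem _ fun t ht => ?_
  rw [C_mul']
  refine Submodule.smul_mem _ _ ?_
  have htk : borderIndex β t ≤ k + 1 := hp ht
  rcases Nat.eq_zero_or_pos (borderIndex β t) with h | h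
  · rw [reduceMonomial_of_borderIndex_eq_zero G h]
    refine (monomial_mem_restrictSupport ℂ).2 (Or.inl ?_)
    simp [h]
  · refine restrictSupport_mono _ (fun u hu => ?_) (reduceMonomial_mem_of_pos G h0 h)
    simp only [Set.mem_ofPred_eq] at hu ⊢
    omega

theorem iterate_reduceOnce_sub_mem (k : ℕ) (p : MvPolynomial (Fin n) ℂ) :
    (reduceOnce G)^[k] p - p ∈ Ideal.span (Set.range (phi G)) := by
  induction k generalizing p with
  | zero => simp
  | succ k ih =>
    rw [Function.iterate_succ_apply, ← sub_add_sub_cancel _ (reduceOnce G p) p]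
    exact Ideal.add_mem _ (ih _) (reduceOnce_sub_mem G p)

theorem iterate_reduceOnce_mem (h0 : 0 ∈ Set.range β) (k : ℕ) {p : MvPolynomial (Fin n) ℂ}
    (hp : p ∈ restrictSupport ℂ {u | borderIndex β u ≤ k}) :
    (reduceOnce G)^[k] p ∈ restrictSupport ℂ (Set.range β) := by
  induction k generalizing p with
  | zero => exact restrictSupport_mono _ (fun u hu => (borderIndex_le_zero_iff h0).1 hu) hp
  | succ k ih =>
    rw [Function.iterate_succ_apply]
    exact ih (reduceOnce_mem G h0 hp)

theorem NF_sub_mem (p : MvPolynomial (Fin n) ℂ) :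
    NF G p - p ∈ Ideal.span (Set.range (phi G)) :=
  iterate_reduceOnce_sub_mem G _ p

theorem NF_mem_restrictSupport (h0 : 0 ∈ Set.range β) (p : MvPolynomial (Fin n) ℂ) :
    NF G p ∈ restrictSupport ℂ (Set.range β) := by
  refine iterate_reduceOnce_mem G h0 _ ?_
  rw [mem_restrictSupport_iff]
  exact fun t ht => Finset.le_sup (f := borderIndex β) ht

theorem exists_eq_sum_of_mem_restrictSupport {p : MvPolynomial (Fin n) ℂ}
    (hp : p ∈ restrictSupport ℂ (Set.range β)) :
    ∃ c : Fin r → ℂ, p = ∑ i, c i • monomial (β i) 1 := by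
  rw [restrictSupport_eq_span, ← Set.range_comp,
    Submodule.mem_span_range_iff_exists_fun] at hp
  obtain ⟨c, hc⟩ := hp
  exact ⟨c, hc.symm⟩

end BorderDivision

/-! ### Commuting matrices as a module structure -/

section CommutingMatrices

/-- Pairwise commuting matrices are the images of the variables under an algebra homomorphism. -/
theorem exists_algHom_of_commute {σ m : Type*} [Fintype m] [DecidableEq m]
    (M : σ → Matrix m m ℂ) (hM : ∀ i j, M i * M j = M j * M i) :
    ∃ ψ : MvPolynomial σ ℂ →ₐ[ℂ] Matrix m m ℂ, ∀ i, ψ (X i) = M i := by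
  -- `aeval` needs a commutative target, hence the passage through the subalgebra generated by the
  -- matrices.
  have hcomm : IsMulCommutative (Algebra.adjoin ℂ (Set.range M)) := by
    refine Algebra.isMulCommutative_adjoin ℂ ?_
    rintro _ ⟨i, rfl⟩ _ ⟨j, rfl⟩
    exact hM i j
  open scoped IsMulCommutative in
  refine ⟨(Algebra.adjoin ℂ (Set.range M)).val.comp
    (aeval fun i => ⟨M i, Algebra.subset_adjoin ⟨i, rfl⟩⟩), fun i => ?_⟩
  simp

end CommutingMatrices

/-! ### Basis property of B₀ and commutation -/

section BorderBasis

variable {n r : ℕ} {β : Fin r → Fin n →₀ ℕ} (G : Matrix (Fin r) (boundary β) ℂ)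

/-- The quotient of `ℂ[y]` by the ideal generated by `φ[G]`. -/
abbrev BorderQuotient : Type :=
  MvPolynomial (Fin n) ℂ ⧸ Ideal.span (Set.range (phi G))

/-- The class of `y ^ βᵢ` modulo the ideal generated by `φ[G]`. -/
def baseClass (i : Fin r) : BorderQuotient G :=
  Ideal.Quotient.mk _ (monomial (β i) 1)

theorem mk_sum_smul_monomial (c : Fin r → ℂ) :
    (Ideal.Quotient.mk _ (∑ i, c i • monomial (β i) 1) : BorderQuotient G) =
      ∑ i, c i • baseClass G i := by
  rw [map_sum]
  rfl

theorem span_baseClass (h0 : 0 ∈ Set.range β) :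
    ⊤ ≤ Submodule.span ℂ (Set.range (baseClass G)) := by
  intro x _
  obtain ⟨p, rfl⟩ := Ideal.Quotient.mk_surjective x
  obtain ⟨c, hc⟩ := exists_eq_sum_of_mem_restrictSupport (NF_mem_restrictSupport G h0 p)
  rw [← Ideal.Quotient.eq.2 (NF_sub_mem G p), hc, mk_sum_smul_monomial]
  exact Submodule.sum_mem _ fun i _ =>
    Submodule.smul_mem _ _ (Submodule.subset_span ⟨i, rfl⟩)

theorem finite_borderQuotient (h0 : 0 ∈ Set.range β) : Module.Finite ℂ (BorderQuotient G) :=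
  Module.Finite.of_surjective (Fintype.linearCombination ℂ (baseClass G))
    (LinearMap.range_eq_top.1 (by
      rw [Fintype.range_linearCombination, eq_top_iff]
      exact span_baseClass G h0))

theorem multMatrix_of_eq (hinj : Function.Injective β) {i : Fin n} {t k : Fin r}
    (h : β t + Finsupp.single i 1 = β k) (s : Fin r) :
    multMatrix G i s t = if s = k then 1 else 0 := by
  have hn : β t + Finsupp.single i 1 ∉ boundary β := fun hmem =>
    (Finset.mem_sdiff.1 hmem).2 (mem_baseSet.2 ⟨k, h.symm⟩)
  rw [multMatrix, Matrix.of_apply, dif_neg hn, h]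
  simp [hinj.eq_iff]

theorem multMatrix_of_mem {i : Fin n} {t : Fin r}
    (h : β t + Finsupp.single i 1 ∈ boundary β) (s : Fin r) :
    multMatrix G i s t = G s ⟨_, h⟩ := by
  rw [multMatrix, Matrix.of_apply, dif_pos h]

theorem mk_X_mul_baseClass (hinj : Function.Injective β) (i : Fin n) (t : Fin r) :
    (Ideal.Quotient.mk _ (X i) : BorderQuotient G) * baseClass G t =
      ∑ s, multMatrix G i s t • baseClass G s := by
  have hmul : (Ideal.Quotient.mk _ (X i) : BorderQuotient G) * baseClass G t =
      Ideal.Quotient.mk _ (monomial (β t + Finsupp.single i 1) 1) := by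
    rw [baseClass, ← map_mul, X, monomial_mul, add_comm, one_mul]
  rw [hmul]
  by_cases h : β t + Finsupp.single i 1 ∈ boundary β
  · simp only [multMatrix_of_mem G h]
    rw [← mk_sum_smul_monomial, eq_comm, Ideal.Quotient.eq]
    simp only [smul_eq_C_mul]
    exact Ideal.subset_span ⟨⟨_, h⟩, rfl⟩
  · obtain ⟨k, hk⟩ : β t + Finsupp.single i 1 ∈ Set.range β := by
      by_contra hn
      exact h (Finset.mem_sdiff.2 ⟨mem_borderSet_add_single t i, mt mem_baseSet.1 hn⟩)
    simp [multMatrix_of_eq G hinj hk.symm, baseClass, hk]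

theorem multMatrix_mul_comm (hinj : Function.Injective β)
    (hind : LinearIndependent ℂ (baseClass G)) (i j : Fin n) :
    multMatrix G i * multMatrix G j = multMatrix G j * multMatrix G i := by
  have key : ∀ (i j : Fin n) (t : Fin r),
      ∑ s, (multMatrix G i * multMatrix G j) s t • baseClass G s =
        (Ideal.Quotient.mk _ (X i) : BorderQuotient G) *
          (Ideal.Quotient.mk _ (X j) * baseClass G t) := by
    intro i j t
    rw [mk_X_mul_baseClass G hinj, Finset.mul_sum]
    simp only [mul_smul_comm, mk_X_mul_baseClass G hinj, Matrix.mul_apply, Finset.sum_smul,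
      Finset.smul_sum, smul_smul]
    rw [Finset.sum_comm]
    simp only [mul_comm]
  ext s t
  have h := (key i j t).trans ((mul_left_comm _ _ _).trans (key j i t).symm)
  rw [← sub_eq_zero, ← Finset.sum_sub_distrib] at h
  simp only [← sub_smul] at h
  exact sub_eq_zero.1 (Fintype.linearIndependent_iff.1 hind _ h s)

/-- With ψ sending yᵢ to Mᵢ(G), the map L p = ψ(p) e, where e is the unit vector at the index of 1,
kills J and sends `y ^ βₜ` to the t-th unit vector. It thus reads off the coefficients of any
relation. -/
theorem linearIndependent_baseClass {Y : Set (Fin n → ℂ)} (hβ : IsFirstIndependent Y β)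
    (hr : 0 < r)
    (hcomm : ∀ i j, multMatrix G i * multMatrix G j = multMatrix G j * multMatrix G i) :
    LinearIndependent ℂ (baseClass G) := by
  obtain ⟨ψ, hψ⟩ := exists_algHom_of_commute (multMatrix G) hcomm
  obtain ⟨t₀, ht₀⟩ := hβ.zero_mem_range hr
  let L : MvPolynomial (Fin n) ℂ →ₗ[ℂ] (Fin r → ℂ) :=
    (Matrix.mulVecBilin ℂ ℂ).flip (Pi.single t₀ 1) ∘ₗ ψ.toLinearMap
  have hL : ∀ p, L p = (ψ p).mulVec (Pi.single t₀ 1) := fun p => rfl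
  have hLmul : ∀ p q, L (p * q) = (ψ p).mulVec (L q) := fun p q => by
    rw [hL, hL, map_mul, Matrix.mulVec_mulVec]
  have hstep : ∀ (i : Fin n) (t : Fin r) (s : Fin r), L (monomial (β t) 1) = Pi.single t 1 →
      L (monomial (β t + Finsupp.single i 1) 1) s = multMatrix G i s t := by
    intro i t s ht
    have : (monomial (β t + Finsupp.single i 1) 1 : MvPolynomial (Fin n) ℂ) =
        X i * monomial (β t) 1 := by
      rw [X, monomial_mul, add_comm, one_mul]
    rw [this, hLmul, ht, hψ]
    simp
  -- Induction on degree: removing a variable stays in B₀, and the matching column of the matrix is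
  -- a unit vector.
  have hbase : ∀ (d : ℕ) (t : Fin r), (β t).degree = d →
      L (monomial (β t) 1) = Pi.single t 1 := by
    intro d
    induction d with
    | zero =>
      intro t hd
      have h0 := (Finsupp.degree_eq_zero_iff _).1 hd
      obtain rfl : t = t₀ := hβ.injective (h0.trans ht₀.symm)
      rw [h0, hL, monomial_zero', C_1, map_one, Matrix.one_mulVec]
    | succ d ih =>
      intro t hd
      have hne : β t ≠ 0 := fun h0 => by simp [h0] at hd
      obtain ⟨i, hi⟩ := Finsupp.ne_iff.1 hne
      have hle : Finsupp.single i 1 ≤ β t := by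
        rw [Finsupp.single_le_iff]
        exact Nat.one_le_iff_ne_zero.2 hi
      have hsub := tsub_add_cancel_of_le hle
      obtain ⟨k, hk⟩ := hβ.mem_range_of_add_single hsub
      rw [← hk] at hsub
      have hdk : (β k).degree = d := by
        have := congrArg Finsupp.degree hsub
        simp only [map_add, Finsupp.degree_single] at this
        omega
      ext s
      rw [← hsub, hstep i k s (ih k hdk), multMatrix_of_eq G hβ.injective hsub, Pi.single_apply]
  have hphi : ∀ α, L (phi G α) = 0 := by
    rintro ⟨α, hα⟩
    obtain ⟨i, t, rfl⟩ := exists_add_single_of_mem_boundary hα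
    ext s
    rw [phi, map_sub, Pi.sub_apply, hstep i t s (hbase _ t rfl), multMatrix_of_mem G hα, map_sum,
      Finset.sum_apply]
    simp [C_mul', hbase _ _ rfl, Pi.single_apply]
  have hker : ∀ p ∈ Ideal.span (Set.range (phi G)), L p = 0 := by
    intro p hp
    induction hp using Submodule.span_induction with
    | mem x hx =>
      obtain ⟨α, rfl⟩ := hx
      exact hphi α
    | zero => exact map_zero L
    | add x y _ _ hx hy => rw [map_add, hx, hy, add_zero]
    | smul a x _ hx => rw [smul_eq_mul, hLmul, hx, Matrix.mulVec_zero]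
  refine Fintype.linearIndependent_iff.2 fun c hc i => ?_
  rw [← mk_sum_smul_monomial, Ideal.Quotient.eq_zero_iff_mem] at hc
  have := congrFun (hker _ hc) i
  simpa [map_sum, map_smul, hbase _ _ rfl, Finset.sum_apply, Pi.single_apply] using this

end BorderBasis

/-! ### Local multiplicities and local inclusion of ideals -/

section LocalMultiplicities

/-- Localization commutes with quotients. This turns multiplicities into dimensions of local rings
of A. -/
theorem finrank_localization_quotient {F A : Type*} [Field F] [CommRing A] [Algebra F A]
    (J q : Ideal A) [q.IsPrime] (q' : Ideal (A ⧸ J)) [q'.IsPrime]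
    (h : q'.comap (Ideal.Quotient.mk J) = q) :
    Module.finrank F (Localization.AtPrime q ⧸
        J.map (algebraMap A (Localization.AtPrime q))) =
      Module.finrank F (Localization.AtPrime q') := by
  have hM : Algebra.algebraMapSubmonoid (A ⧸ J) q.primeCompl = q'.primeCompl := by
    ext x
    constructor
    · rintro ⟨a, ha, rfl⟩ hx
      exact ha (h ▸ hx)
    · intro hx
      obtain ⟨a, rfl⟩ := Ideal.Quotient.mk_surjective x
      exact ⟨a, fun ha => hx (by rw [← h] at ha; exact ha), rfl⟩
  have hloc : IsLocalization q'.primeCompl (Localization.AtPrime q ⧸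
      J.map (algebraMap A (Localization.AtPrime q))) := by
    rw [← hM]
    infer_instance
  have : IsScalarTower F (A ⧸ J) (Localization.AtPrime q ⧸
      J.map (algebraMap A (Localization.AtPrime q))) :=
    IsScalarTower.of_algebraMap_eq fun x => rfl
  exact (((IsLocalization.algEquiv q'.primeCompl (Localization.AtPrime q ⧸
    J.map (algebraMap A (Localization.AtPrime q))) (Localization.AtPrime q')).restrictScalars
      F).toLinearEquiv).finrank_eq

variable {n : ℕ} {ι : Type*} (F : ι → MvPolynomial (Fin n) ℂ)

theorem mem_solutions_iff {v : Fin n → ℂ} :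
    v ∈ solutions F ↔ Ideal.span (Set.range F) ≤ vanishingIdeal ℂ {v} := by
  rw [Ideal.span_le]
  constructor
  · rintro h _ ⟨i, rfl⟩
    exact (mem_vanishingIdeal_singleton_iff v _).2 (by rw [aeval_eq_eval]; exact h i)
  · intro h i
    have := (mem_vanishingIdeal_singleton_iff v _).1 (h ⟨i, rfl⟩)
    rwa [aeval_eq_eval] at this

theorem vanishingIdeal_singleton_injective {v w : Fin n → ℂ}
    (h : (vanishingIdeal ℂ {v} : Ideal (MvPolynomial (Fin n) ℂ)) = vanishingIdeal ℂ {w}) :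
    v = w := by
  ext i
  have hm : X i - C (w i) ∈ (vanishingIdeal ℂ {w} : Ideal (MvPolynomial (Fin n) ℂ)) := by
    rw [mem_vanishingIdeal_singleton_iff]
    simp
  rw [← h, mem_vanishingIdeal_singleton_iff] at hm
  simpa [sub_eq_zero] using hm

/-- If `ℂ[y] / (F)` is finite-dimensional, then `F = 0` has finitely many solutions, and their
number counted with multiplicities is that dimension. -/
theorem hasSolutionsCounted_finrank
    [hfin : Module.Finite ℂ (MvPolynomial (Fin n) ℂ ⧸ Ideal.span (Set.range F))] :
    HasSolutionsCounted F
      (Module.finrank ℂ (MvPolynomial (Fin n) ℂ ⧸ Ideal.span (Set.range F))) := by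
  set J := Ideal.span (Set.range F) with hJ
  have : IsArtinianRing (MvPolynomial (Fin n) ℂ ⧸ J) := IsArtinianRing.of_finite ℂ _
  have : Fintype (PrimeSpectrum (MvPolynomial (Fin n) ℂ ⧸ J)) := Fintype.ofFinite _
  -- Primes of an Artinian ring are maximal, so by the Nullstellensatz each one is a point.
  have hex : ∀ p : PrimeSpectrum (MvPolynomial (Fin n) ℂ ⧸ J), ∃ v : Fin n → ℂ,
      p.asIdeal.comap (Ideal.Quotient.mk J) = vanishingIdeal ℂ {v} := by
    intro p
    have hmax : p.asIdeal.IsMaximal := IsArtinianRing.isMaximal_of_isPrime p.asIdeal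
    exact isMaximal_iff_eq_vanishingIdeal_singleton.1
      (Ideal.comap_isMaximal_of_surjective _ Ideal.Quotient.mk_surjective)
  choose e he using hex
  have hinj : Function.Injective e := by
    intro p q hpq
    refine PrimeSpectrum.ext
      (Ideal.comap_injective_of_surjective _ (Ideal.Quotient.mk_surjective (I := J)) ?_)
    rw [he, he, hpq]
  have hrange : Set.range e = solutions F := by
    ext v
    rw [mem_solutions_iff]
    constructor
    · rintro ⟨p, rfl⟩
      rw [← he, ← hJ]
      intro x hx
      rw [Ideal.mem_comap, Ideal.Quotient.eq_zero_iff_mem.2 hx]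
      exact zero_mem _
    · intro hv
      have hker : RingHom.ker (Ideal.Quotient.mk J) ≤ vanishingIdeal ℂ {v} := by
        rwa [Ideal.mk_ker]
      let p : PrimeSpectrum (MvPolynomial (Fin n) ℂ ⧸ J) :=
        ⟨(vanishingIdeal ℂ {v}).map (Ideal.Quotient.mk J),
          Ideal.map_isPrime_of_surjective Ideal.Quotient.mk_surjective hker⟩
      refine ⟨p, vanishingIdeal_singleton_injective ?_⟩
      rw [← he, Ideal.comap_map_of_surjective' _ Ideal.Quotient.mk_surjective]
      exact sup_eq_left.2 hker
  refine ⟨hrange ▸ Set.finite_range e, ?_⟩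
  rw [← hrange, finsum_mem_range hinj, finsum_eq_sum_of_fintype,
    IsArtinianRing.finrank_eq_sum_primeSpectrum]
  exact Finset.sum_congr rfl fun p _ => finrank_localization_quotient J _ p.asIdeal (he p)

/-- The inclusion is checked at each maximal ideal, that is, at each point. Away from the solutions
some element of the ideal of F is a unit, so nothing is required there. -/
theorem le_of_solutionsBelongTo {Y : Set (Fin n → ℂ)} (h : SolutionsBelongTo F Y) :
    vanishingIdeal ℂ Y ≤ Ideal.span (Set.range F) := by
  refine Ideal.le_of_localization_maximal fun P hP => ?_
  obtain ⟨v, rfl⟩ := isMaximal_iff_eq_vanishingIdeal_singleton.1 hP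
  by_cases hv : v ∈ solutions F
  · exact (h v hv).2
  · rw [mem_solutions_iff] at hv
    obtain ⟨x, hx, hxv⟩ := SetLike.not_le_iff_exists.1 hv
    rw [Ideal.eq_top_of_isUnit_mem _ (Ideal.mem_map_of_mem _ hx)
      (IsLocalization.map_units _ (⟨x, hxv⟩ : (vanishingIdeal ℂ {v}).primeCompl))]
    exact le_top

theorem solutionsBelongTo_of_le {Y : Set (Fin n → ℂ)}
    (hY : zeroLocus ℂ (vanishingIdeal ℂ Y : Ideal (MvPolynomial (Fin n) ℂ)) ⊆ Y)
    (h : vanishingIdeal ℂ Y ≤ Ideal.span (Set.range F)) : SolutionsBelongTo F Y := by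
  refine fun v hv => ⟨hY fun p hp => ?_, Ideal.map_mono h⟩
  exact (mem_vanishingIdeal_singleton_iff v p).1 ((mem_solutions_iff F).1 hv (h hp))

end LocalMultiplicities

/-- `Y` is Zariski closed. -/
theorem zeroLocus_vanishingIdeal_dehomogenization {n M : ℕ}
    (h : Fin M → MvPolynomial (Fin (n + 1)) ℂ) :
    zeroLocus ℂ (vanishingIdeal ℂ (dehomogenization h) : Ideal (MvPolynomial (Fin n) ℂ)) ⊆
      dehomogenization h := by
  intro y hy k
  -- The polynomial h_k(1, y), which vanishes on `Y` by definition.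
  let q : MvPolynomial (Fin n) ℂ :=
    aeval (Fin.cons 1 X : Fin (n + 1) → MvPolynomial (Fin n) ℂ) (h k)
  have hq : ∀ z : Fin n → ℂ, aeval z q = eval (Fin.cons 1 z : Fin (n + 1) → ℂ) (h k) := by
    intro z
    have hcomp : (aeval z).comp (aeval (Fin.cons 1 X : Fin (n + 1) → MvPolynomial (Fin n) ℂ)) =
        aeval (R := ℂ) (Fin.cons 1 z : Fin (n + 1) → ℂ) := by
      refine algHom_ext fun i => ?_
      refine Fin.cases ?_ (fun j => ?_) i <;> simp
    rw [← aeval_eq_eval, ← hcomp]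
    rfl
  rw [← hq]
  exact hy q fun z hz => (hq z).trans (hz k)

theorem HasSolutionsCounted.unique {n : ℕ} {ι : Type*} {F : ι → MvPolynomial (Fin n) ℂ} {a b : ℕ}
    (ha : HasSolutionsCounted F a) (hb : HasSolutionsCounted F b) : a = b :=
  ha.2.symm.trans hb.2

end STDX

end

/-! ### The equivalence -/

theorem theorem3p4 {n M N r : ℕ} (hr : 0 < r)
    (h : Fin M → MvPolynomial (Fin (n + 1)) ℂ)
    (h_hom : ∀ k, ∃ d, (h k).IsHomogeneous d)
    (g : Fin N → MvPolynomial (Fin n) ℂ)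
    (hg : Ideal.span (Set.range g) =
      MvPolynomial.vanishingIdeal ℂ (STDX.dehomogenization h))
    (β : Fin r → Fin n →₀ ℕ)
    (hβ : STDX.IsFirstIndependent (STDX.dehomogenization h) β)
    (G : Matrix (Fin r) (STDX.boundary β) ℂ) :
    (STDX.HasSolutionsCounted (STDX.phi G) r ∧
      STDX.SolutionsBelongTo (STDX.phi G) (STDX.dehomogenization h)) ↔
    ((∀ i j : Fin n, i < j →
        STDX.multMatrix G i * STDX.multMatrix G j
          - STDX.multMatrix G j * STDX.multMatrix G i = 0) ∧
      ∀ k : Fin N, STDX.NF G (g k) = 0) := by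
  have h0 := hβ.zero_mem_range hr
  have := STDX.finite_borderQuotient G h0
  have hcount := STDX.hasSolutionsCounted_finrank (STDX.phi G)
  have hspan := STDX.span_baseClass G h0
  constructor
  · rintro ⟨hsol, hY⟩
    -- The r spanning classes are independent because the solution count forces dim A = r.
    have hind : LinearIndependent ℂ (STDX.baseClass G) :=
      linearIndependent_of_top_le_span_of_card_eq_finrank hspan
        ((Fintype.card_fin r).trans (hsol.unique hcount))
    refine ⟨fun i j _ => sub_eq_zero.2 (STDX.multMatrix_mul_comm G hβ.injective hind i j),
      fun k => ?_⟩
    have hgk : g k ∈ Ideal.span (Set.range (STDX.phi G)) :=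
      STDX.le_of_solutionsBelongTo _ hY (hg ▸ Ideal.subset_span ⟨k, rfl⟩)
    -- The remainder lies in J and is a combination of B₀, so independence makes every coefficient
    -- zero.
    have hmem := Ideal.add_mem _ (STDX.NF_sub_mem G (g k)) hgk
    rw [sub_add_cancel] at hmem
    obtain ⟨c, hc⟩ := STDX.exists_eq_sum_of_mem_restrictSupport
      (STDX.NF_mem_restrictSupport G h0 (g k))
    rw [hc, ← Ideal.Quotient.eq_zero_iff_mem, STDX.mk_sum_smul_monomial] at hmem
    rw [hc]
    exact Finset.sum_eq_zero fun i _ => by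
      rw [Fintype.linearIndependent_iff.1 hind c hmem i, zero_smul]
  · rintro ⟨hlt, hNF⟩
    have hcomm : ∀ i j, STDX.multMatrix G i * STDX.multMatrix G j =
        STDX.multMatrix G j * STDX.multMatrix G i := by
      intro i j
      rcases lt_trichotomy i j with hij | rfl | hij
      · exact sub_eq_zero.1 (hlt i j hij)
      · rfl
      · exact (sub_eq_zero.1 (hlt j i hij)).symm
    have hind := STDX.linearIndependent_baseClass G hβ hr hcomm
    have hrank : Module.finrank ℂ (STDX.BorderQuotient G) = r := by
      rw [Module.finrank_eq_card_basis (Module.Basis.mk hind hspan), Fintype.card_fin]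
    refine ⟨by rwa [hrank] at hcount, STDX.solutionsBelongTo_of_le _
      (STDX.zeroLocus_vanishingIdeal_dehomogenization h) ?_⟩
    rw [← hg, Ideal.span_le]
    rintro _ ⟨k, rfl⟩
    have hmem := STDX.NF_sub_mem G (g k)
    rw [hNF k, zero_sub] at hmem
    exact neg_mem_iff.1 hmem
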